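/- Let $F$ be a free semigroup (the semigroup of nonempty words under concatenation) on a set with at least two elements, and let $L$ be a left ideal of $F$, i.e. a nonempty subset $L\subseteq F$ such that $fx\in L$ for all $f\in F$, $x\in L$; regard $L$ as a semigroup. For a semigroup $S$, an $S$-module is an abelian group $A$ with a left action of $S$ by additive endomorphisms such that $(xy)a=x(ya)$ (a left module over $\mathbf{Z}S$), and $H^n(S,A)$ $(n\ge 0)$ is the $n$-th cohomology group of the complex of groups $C^n(S,A)$ of all maps $f:S^n\to A$ with differential $$\partial^n f(x_1,\ldots,x_{n+1})=x_1f(x_2,\ldots,x_{n+1})+\sum_{i=1}^n(-1)^if(x_1,\ldots,x_ix_{i+1},\ldots,x_{n+1})+(-1)^{n+1}f(x_1,\ldots,x_n).$$ The cohomological dimension of $S$ is the largest $n$ such that $H^n(S,A)\neq 0$ for some $S$-module $A$ (and $\infty$ if there are arbitrarily large such $n$). Then $L$ has cohomological dimension $1$ if and only if $L$ is a free semigroup, i.e. isomorphic to the semigroup of nonempty words over some set. -/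

import Mathlib

universe u v

namespace SemigroupCohomology

/-- A left module over the integral semigroup ring of `S` (`S` need not have an identity) is an
abelian group `A` together with a multiplicative map `ρ` from `S` to the additive endomorphisms
of `A`; the element `s` acts on `a` as `ρ s a`. -/
abbrev Action (S : Type u) [Semigroup S] (A : Type v) [AddCommGroup A] : Type (max u v) :=
  S →ₙ* AddMonoid.End A

/-- The group of `n`-cochains: all maps from `S × ⋯ × S` (`n` times) to `A`. -/
abbrev Cochain (S : Type u) (A : Type v) (n : ℕ) : Type (max u v) :=
  (Fin n → S) → A

section

variable {S : Type u} [Semigroup S] {A : Type v} [AddCommGroup A] (ρ : Action S A)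

/-- The coboundary homomorphism
`∂f (x₁, …, xₙ₊₁) = x₁ f (x₂, …, xₙ₊₁) + ∑ᵢ (-1)ⁱ f (x₁, …, xᵢ xᵢ₊₁, …, xₙ₊₁)
  + (-1)ⁿ⁺¹ f (x₁, …, xₙ)`.
The index `j : Fin n` is `i - 1`, and `Fin.contractNth` multiplies two adjacent entries. -/
def coboundary (n : ℕ) : Cochain S A n →+ Cochain S A (n + 1) where
  toFun f x :=
    ρ (x 0) (f (Fin.tail x))
      + ∑ j : Fin n, (-1 : ℤ) ^ ((j : ℕ) + 1) • f (Fin.contractNth j.castSucc (· * ·) x)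
      + (-1 : ℤ) ^ (n + 1) • f (Fin.init x)
  map_zero' := by
    funext x
    simp
  map_add' f g := by
    funext x
    simp only [Pi.add_apply, map_add, smul_add, Finset.sum_add_distrib]
    abel

/-- The group of `n`-cocycles. -/
def cocycles (n : ℕ) : AddSubgroup (Cochain S A n) :=
  (coboundary ρ n).ker

/-- The group of `n`-coboundaries; it is zero for `n = 0`. -/
def coboundaries : (n : ℕ) → AddSubgroup (Cochain S A n)
  | 0 => ⊥
  | n + 1 => (coboundary ρ n).range

/-- The `n`-th cohomology group of `S` with coefficients in the module `A`: cocycles modulo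
coboundaries. -/
abbrev H (n : ℕ) : Type (max u v) :=
  cocycles ρ n ⧸ (coboundaries ρ n).addSubgroupOf (cocycles ρ n)

end

/-- The cohomological dimension of a semigroup `S`: the largest `n` for which some `S`-module has
a nonzero `n`-th cohomology group (`⊤` if there are arbitrarily large such `n`). -/
noncomputable def cohomologicalDimension (S : Type u) [Semigroup S] : ℕ∞ :=
  ⨆ n ∈ {n : ℕ | ∃ (A : Type u) (_ : AddCommGroup A) (ρ : Action S A), Nontrivial (H ρ n)},
    (n : ℕ∞)

/-- A semigroup is free if it is isomorphic to the semigroup of nonempty words over some set. -/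
def IsFree (S : Type u) [Semigroup S] : Prop :=
  ∃ X : Type u, Nonempty (S ≃* FreeSemigroup X)

end SemigroupCohomology

/-- A left ideal of a semigroup, regarded as a subsemigroup. -/
def SemigroupIdeal.toSubsemigroup {S : Type u} [Semigroup S] (L : SemigroupIdeal S) :
    Subsemigroup S where
  carrier := L
  mul_mem' {x _} _ hy := L.mul_mem x hy

/-!
A cochain on a free semigroup can be prescribed where its first argument is a letter: every such
prescription comes from a coboundary, by recursion on the length of the first argument, and a
cocycle that vanishes there is zero. So a free semigroup has no cohomology in degrees above one,
whereas the length of words represents a nonzero class in degree one.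

Conversely, suppose that `L` has no second cohomology, and let `x` and `x * u` be in `L`. Let `c s`
be `1` if the word `s` starts with a fixed letter and `0` otherwise. Then `(s, t) ↦ c t • s` is a
cocycle with values in `ℤ[L]`. If `u` were not in `L`, the coefficients of `x * u` in a primitive of
this cocycle would show that `c` is constant on `L`, which is impossible because `L` contains words
starting with any letter. So `u` is in `L`, two factorizations in `L` of the same word have a common
refinement in `L`, and `L` is free on its indecomposable elements.
-/

namespace SemigroupCohomology

section Functoriality

variable {S : Type*} [Semigroup S] {A : Type*} [AddCommGroup A] (ρ : Action S A)
  {T : Type*} [Semigroup T] {B : Type*} [AddCommGroup B] (σ : Action T B)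

theorem coboundary_map_comp (φ : T →ₙ* S) (θ : A →+ B)
    (h : ∀ t a, θ (ρ (φ t) a) = σ t (θ a)) {n : ℕ} (f : Cochain S A n) :
    coboundary σ n (fun x ↦ θ (f (φ ∘ x))) = fun x ↦ θ (coboundary ρ n f (φ ∘ x)) := by
  funext x
  have contract (j : Fin n) : Fin.contractNth j.castSucc (· * ·) (φ ∘ x) =
      φ ∘ Fin.contractNth j.castSucc (· * ·) x :=
    (Fin.comp_contractNth _ _ (map_mul φ) _ _).symm
  simp only [coboundary, AddMonoidHom.coe_mk, ZeroHom.coe_mk, map_add, map_sum, map_zsmul, contract]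
  exact congrArg (· + _ + _) (h _ _).symm

theorem comp_mem_cocycles {φ : T →ₙ* S} {n : ℕ} {f : Cochain S A n} (hf : f ∈ cocycles ρ n) :
    (fun x ↦ f (φ ∘ x)) ∈ cocycles (ρ.comp φ) n := by
  have hf : coboundary ρ n f = 0 := hf
  refine (coboundary_map_comp ρ (ρ.comp φ) φ (.id A) (fun _ _ ↦ rfl) f).trans ?_
  simp only [hf]
  rfl

theorem comp_mem_coboundaries {φ : T →ₙ* S} {n : ℕ} {f : Cochain S A n}
    (hf : f ∈ coboundaries ρ n) : (fun x ↦ f (φ ∘ x)) ∈ coboundaries (ρ.comp φ) n := by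
  cases n with
  | zero =>
    obtain rfl : f = 0 := hf
    exact zero_mem _
  | succ n =>
    obtain ⟨g, rfl⟩ := hf
    exact ⟨_, coboundary_map_comp ρ (ρ.comp φ) φ (.id A) (fun _ _ ↦ rfl) g⟩

theorem cocycles_le_coboundaries_of_mulEquiv (e : T ≃* S) {n : ℕ}
    (h : cocycles (ρ.comp e.toMulHom) n ≤ coboundaries (ρ.comp e.toMulHom) n) :
    cocycles ρ n ≤ coboundaries ρ n := by
  intro f hf
  have hf' := comp_mem_coboundaries _ (φ := e.symm.toMulHom) (h (comp_mem_cocycles ρ hf))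
  have hρ : (ρ.comp e.toMulHom).comp e.symm.toMulHom = ρ :=
    MulHom.ext fun s ↦ congrArg ρ (e.apply_symm_apply s)
  have hfe : (fun x ↦ f (e ∘ e.symm ∘ x)) = f :=
    funext fun x ↦ congrArg f (funext fun i ↦ e.apply_symm_apply (x i))
  rw [hρ] at hf'
  exact hfe ▸ hf'

end Functoriality

section Dimension

variable {S T : Type u} [Semigroup S] [Semigroup T]

theorem nontrivial_H_iff {A : Type*} [AddCommGroup A] (ρ : Action S A) (n : ℕ) :
    Nontrivial (H ρ n) ↔ ¬ cocycles ρ n ≤ coboundaries ρ n := by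
  rw [← not_subsingleton_iff_nontrivial, QuotientAddGroup.subsingleton_iff,
    AddSubgroup.addSubgroupOf_eq_top]

theorem cohomologicalDimension_le_iff {n : ℕ} :
    cohomologicalDimension S ≤ n ↔ ∀ m, n < m → ∀ (A : Type u) [AddCommGroup A] (ρ : Action S A),
      cocycles ρ m ≤ coboundaries ρ m := by
  simp only [cohomologicalDimension, iSup_le_iff, Set.mem_ofPred_eq, nontrivial_H_iff,
    forall_exists_index, Nat.cast_le]
  refine forall_congr' fun m ↦ ⟨fun h hm A _ ρ ↦ ?_, fun h A _ ρ hρ ↦ ?_⟩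
  · by_contra hρ
    exact hm.not_ge (h A _ ρ hρ)
  · by_contra! hm
    exact hρ (h hm A ρ)

theorem cohomologicalDimension_le_of_mulEquiv (e : S ≃* T) :
    cohomologicalDimension S ≤ cohomologicalDimension T :=
  iSup₂_mono' fun n ⟨A, _, ρ, hρ⟩ ↦ ⟨n, ⟨A, _, ρ.comp e.symm.toMulHom, (nontrivial_H_iff _ n).2
    fun h ↦ (nontrivial_H_iff ρ n).1 hρ (cocycles_le_coboundaries_of_mulEquiv ρ e.symm h)⟩, le_rfl⟩

theorem cohomologicalDimension_congr (e : S ≃* T) :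
    cohomologicalDimension S = cohomologicalDimension T :=
  (cohomologicalDimension_le_of_mulEquiv e).antisymm (cohomologicalDimension_le_of_mulEquiv e.symm)

end Dimension

section FinTuples

variable {S : Type*}

theorem contractNth_zero_cons (op : S → S → S) {n : ℕ} (a : S) (x : Fin (n + 1) → S) :
    Fin.contractNth 0 op (Fin.cons a x : Fin (n + 2) → S) =
      (Fin.cons (op a (x 0)) (Fin.tail x) : Fin (n + 1) → S) := by
  funext i
  cases i using Fin.cases <;> simp [Fin.contractNth, Fin.tail]

theorem contractNth_succ_cons (op : S → S → S) {n : ℕ} (j : Fin (n + 1)) (a : S)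
    (x : Fin (n + 1) → S) :
    Fin.contractNth j.succ op (Fin.cons a x : Fin (n + 2) → S) =
      Fin.cons a (Fin.contractNth j op x) := by
  funext i
  cases i using Fin.cases <;> simp [Fin.contractNth]

theorem init_cons {n : ℕ} (a : S) (x : Fin (n + 1) → S) :
    Fin.init (Fin.cons a x : Fin (n + 2) → S) = Fin.cons a (Fin.init x) := by
  funext i
  cases i using Fin.cases <;> rfl

end FinTuples

section Complex

variable {S : Type*} [Semigroup S] {A : Type*} [AddCommGroup A] (ρ : Action S A)

/-- The action in which every element of the semigroup acts as zero. Its coboundary consists of all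
the terms of a general coboundary except the first one, the only term that involves the action. -/
def zeroAction (S A : Type*) [Semigroup S] [AddCommGroup A] : Action S A where
  toFun _ := 0
  map_mul' _ _ := (mul_zero _).symm

@[simp]
theorem zeroAction_apply (s : S) (a : A) : zeroAction S A s a = 0 := rfl

/-- The first term `x₁ f (x₂, …, xₙ₊₁)` of the coboundary of `f`. -/
def leadingTerm {n : ℕ} (f : Cochain S A n) : Cochain S A (n + 1) :=
  fun x ↦ ρ (x 0) (f (Fin.tail x))

theorem coboundary_eq_leadingTerm_add {n : ℕ} (f : Cochain S A n) :
    coboundary ρ n f = leadingTerm ρ f + coboundary (zeroAction S A) n f := by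
  funext x
  simp [coboundary, leadingTerm, add_assoc]

theorem coboundary_cons {n : ℕ} (f : Cochain S A (n + 1)) (a : S) (x : Fin (n + 1) → S) :
    coboundary ρ (n + 1) f (Fin.cons a x) = ρ a (f x) - f (Fin.cons (a * x 0) (Fin.tail x)) -
      coboundary (zeroAction S A) n (fun y ↦ f (Fin.cons a y)) x := by
  simp only [coboundary, zeroAction_apply, AddMonoidHom.coe_mk, ZeroHom.coe_mk, zero_add,
    Fin.sum_univ_succ, init_cons, Fin.cons_zero, Fin.tail_cons, Fin.castSucc_zero,
    contractNth_zero_cons, Fin.castSucc_succ, contractNth_succ_cons, Fin.val_zero, Fin.val_succ,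
    pow_succ, pow_zero, mul_neg, mul_one, neg_smul, one_smul, Finset.sum_neg_distrib]
  abel

theorem coboundary_zeroAction_cons {n : ℕ} (f : Cochain S A (n + 1)) (a : S)
    (x : Fin (n + 1) → S) :
    coboundary (zeroAction S A) (n + 1) f (Fin.cons a x) =
      -f (Fin.cons (a * x 0) (Fin.tail x)) -
        coboundary (zeroAction S A) n (fun y ↦ f (Fin.cons a y)) x := by
  rw [coboundary_cons, zeroAction_apply, zero_sub]

theorem coboundary_zeroAction_mul_left {n : ℕ} (f : Cochain S A (n + 1)) (a : S)
    (x : Fin (n + 2) → S) :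
    coboundary (zeroAction S A) (n + 1) (fun y ↦ f (Fin.cons (a * y 0) (Fin.tail y))) x =
      coboundary (zeroAction S A) (n + 1) f (Fin.cons (a * x 0) (Fin.tail x)) := by
  cases x using Fin.consCases with
  | cons b x => simp only [coboundary_zeroAction_cons, Fin.cons_zero, Fin.tail_cons, mul_assoc]

theorem coboundary_zeroAction_coboundary_zeroAction {n : ℕ} (f : Cochain S A n) :
    coboundary (zeroAction S A) (n + 1) (coboundary (zeroAction S A) n f) = 0 := by
  funext x
  induction n with
  | zero => simp [coboundary, Subsingleton.elim _ (Fin.elim0 : Fin 0 → S)]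
  | succ n ih =>
    cases x using Fin.consCases with | cons a x =>
    have curried : (fun y ↦ coboundary (zeroAction S A) (n + 1) f (Fin.cons a y)) =
        -(fun y ↦ f (Fin.cons (a * y 0) (Fin.tail y))) -
          coboundary (zeroAction S A) n (fun y ↦ f (Fin.cons a y)) :=
      funext fun y ↦ coboundary_zeroAction_cons f a y
    rw [coboundary_zeroAction_cons, curried, map_sub, map_neg, Pi.sub_apply, Pi.neg_apply,
      coboundary_zeroAction_mul_left, ih]
    simp

theorem coboundary_zeroAction_leadingTerm {n : ℕ} (f : Cochain S A n) :
    coboundary (zeroAction S A) (n + 1) (leadingTerm ρ f) = -leadingTerm ρ (coboundary ρ n f) := by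
  funext x
  cases x using Fin.consCases with | cons a x =>
  have curried : coboundary (zeroAction S A) n (fun y ↦ ρ a (f y)) x =
      ρ a (coboundary (zeroAction S A) n f x) :=
    congrFun (coboundary_map_comp (zeroAction S A) (zeroAction S A) (.id S) (ρ a)
      (fun _ _ ↦ map_zero _) f) x
  rw [coboundary_zeroAction_cons, coboundary_eq_leadingTerm_add ρ]
  simp only [leadingTerm, Fin.cons_zero, Fin.tail_cons, curried, Pi.neg_apply, Pi.add_apply,
    map_add, map_mul, AddMonoid.End.coe_mul, Function.comp_apply]
  abel

theorem coboundary_coboundary {n : ℕ} (f : Cochain S A n) :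
    coboundary ρ (n + 1) (coboundary ρ n f) = 0 := by
  rw [coboundary_eq_leadingTerm_add ρ (coboundary ρ n f)]
  nth_rw 2 [coboundary_eq_leadingTerm_add ρ f]
  rw [map_add, coboundary_zeroAction_leadingTerm, coboundary_zeroAction_coboundary_zeroAction]
  abel

end Complex

section FreeVanishing

variable {X : Type*} {A : Type*} [AddCommGroup A] (ρ : Action (FreeSemigroup X) A)

theorem eq_zero_of_mem_cocycles_of_generators {n : ℕ} {f : Cochain (FreeSemigroup X) A (n + 1)}
    (hf : f ∈ cocycles ρ (n + 1)) (hgen : ∀ a x, f (Fin.cons (.of a) x) = 0) : f = 0 := by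
  have hf : coboundary ρ (n + 1) f = 0 := hf
  funext x
  cases x using Fin.consCases with | cons w x =>
  induction w using FreeSemigroup.recOnMul with
  | ih1 a => exact hgen a x
  | ih2 a w _ ih =>
    have curried : (fun y ↦ f (Fin.cons (.of a) y)) = 0 := funext (hgen a)
    have h := coboundary_cons ρ f (.of a) (Fin.cons w x)
    rw [hf, curried, ih] at h
    simpa using h

theorem exists_word_recursion {B : Type*} (base : X → B) (step : X → FreeSemigroup X → B → B) :
    ∃ h : FreeSemigroup X → B,
      (∀ a, h (.of a) = base a) ∧ ∀ a w, h (.of a * w) = step a w (h w) :=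
  ⟨fun w ↦ w.recOnMul base fun a w _ b ↦ step a w b, fun _ ↦ rfl, fun _ _ ↦ rfl⟩

theorem exists_coboundary_eq_on_generators {n : ℕ} (f : Cochain (FreeSemigroup X) A (n + 2)) :
    ∃ g, ∀ a x, coboundary ρ (n + 1) g (Fin.cons (.of a) x) = f (Fin.cons (.of a) x) := by
  obtain ⟨h, h_of, h_mul⟩ := exists_word_recursion (B := Cochain (FreeSemigroup X) A n) (fun _ ↦ 0)
    fun a w p y ↦ ρ (.of a) (p y) - f (Fin.cons (.of a) (Fin.cons w y))
  refine ⟨fun x ↦ h (x 0) (Fin.tail x), fun a x ↦ ?_⟩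
  have curried : (fun y : Fin n → FreeSemigroup X ↦ h (.of a) y) = 0 := h_of a
  rw [coboundary_cons]
  simp only [Fin.cons_zero, Fin.tail_cons, h_mul, Fin.cons_self_tail]
  rw [curried, map_zero, Pi.zero_apply, sub_zero, sub_sub_cancel]

theorem cocycles_le_coboundaries_freeSemigroup (n : ℕ) :
    cocycles ρ (n + 2) ≤ coboundaries ρ (n + 2) := by
  intro f hf
  obtain ⟨g, hg⟩ := exists_coboundary_eq_on_generators ρ f
  have hcocycle : f - coboundary ρ (n + 1) g ∈ cocycles ρ (n + 2) :=
    sub_mem hf (coboundary_coboundary ρ g)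
  have hzero := eq_zero_of_mem_cocycles_of_generators ρ hcocycle
    fun a x ↦ sub_eq_zero.2 (hg a x).symm
  exact ⟨g, (sub_eq_zero.1 hzero).symm⟩

end FreeVanishing

section LowDegree

variable {S : Type*} [Semigroup S] {A : Type*} [AddCommGroup A] (ρ : Action S A)

theorem coboundary_zero_apply (f : Cochain S A 0) (s : S) :
    coboundary ρ 0 f ![s] = ρ s (f ![]) - f ![] := by
  simp [coboundary, Subsingleton.elim _ (![] : Fin 0 → S), sub_eq_add_neg]

theorem coboundary_one_apply (f : Cochain S A 1) (s t : S) :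
    coboundary ρ 1 f ![s, t] = ρ s (f ![t]) - f ![s * t] + f ![s] := by
  rw [Matrix.vecCons, coboundary_cons, coboundary_zero_apply, zeroAction_apply, zero_sub,
    sub_neg_eq_add]
  rfl

theorem coboundary_two_apply (f : Cochain S A 2) (s t u : S) :
    coboundary ρ 2 f ![s, t, u] = ρ s (f ![t, u]) - f ![s * t, u] + f ![s, t * u] - f ![s, t] := by
  rw [Matrix.vecCons, coboundary_cons, coboundary_one_apply, zeroAction_apply, zero_sub,
    neg_add_eq_sub, sub_sub_eq_add_sub]
  rfl

theorem mem_cocycles_one {f : Cochain S A 1} :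
    f ∈ cocycles ρ 1 ↔ ∀ s t, ρ s (f ![t]) - f ![s * t] + f ![s] = 0 := by
  simp only [← coboundary_one_apply]
  refine funext_iff.trans ?_
  simp only [Fin.forall_fin_succ_pi, Fin.forall_fin_zero_pi]
  rfl

theorem mem_cocycles_two {f : Cochain S A 2} :
    f ∈ cocycles ρ 2 ↔
      ∀ s t u, ρ s (f ![t, u]) - f ![s * t, u] + f ![s, t * u] - f ![s, t] = 0 := by
  simp only [← coboundary_two_apply]
  refine funext_iff.trans ?_
  simp only [Fin.forall_fin_succ_pi, Fin.forall_fin_zero_pi]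
  rfl

theorem nontrivial_H_one {φ : S →ₙ* Multiplicative A} (hφ : φ ≠ 1) :
    Nontrivial (H (1 : Action S A) 1) := by
  rw [nontrivial_H_iff]
  intro hle
  let f : Cochain S A 1 := fun x ↦ (φ (x 0)).toAdd
  have hf : f ∈ cocycles 1 1 := by
    refine (mem_cocycles_one 1).2 fun s t ↦ ?_
    change (φ t).toAdd - (φ (s * t)).toAdd + (φ s).toAdd = 0
    rw [map_mul, toAdd_mul]
    abel
  obtain ⟨g, hg⟩ := hle hf
  refine hφ (MulHom.ext fun s ↦ ?_)
  have h := congrFun hg ![s]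
  rw [coboundary_zero_apply] at h
  exact congrArg Multiplicative.ofAdd (h.symm.trans (sub_self _))

end LowDegree

theorem cohomologicalDimension_freeSemigroup_le_one (X : Type u) :
    cohomologicalDimension (FreeSemigroup X) ≤ 1 := by
  refine cohomologicalDimension_le_iff.2 fun m hm A _ ρ ↦ ?_
  obtain ⟨n, rfl⟩ := Nat.exists_eq_add_of_le' hm
  exact cocycles_le_coboundaries_freeSemigroup ρ n

theorem one_le_cohomologicalDimension_freeSemigroup (X : Type u) [Nonempty X] :
    1 ≤ cohomologicalDimension (FreeSemigroup X) := by
  have a : X := Classical.arbitrary X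
  let φ : FreeSemigroup X →ₙ* Multiplicative (ULift.{u} ℤ) :=
    FreeSemigroup.lift fun _ ↦ .ofAdd 1
  have hφ : φ ≠ 1 := fun h ↦
    one_ne_zero (congrArg Multiplicative.toAdd (DFunLike.congr_fun h (.of a)))
  exact le_iSup₂_of_le (f := fun (n : ℕ) _ ↦ (n : ℕ∞)) 1
    ⟨ULift.{u} ℤ, inferInstance, 1, nontrivial_H_one hφ⟩ Nat.cast_one.ge

theorem cohomologicalDimension_eq_one_of_isFree {S : Type u} [Semigroup S] [hS : Nonempty S]
    (h : IsFree S) : cohomologicalDimension S = 1 := by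
  obtain ⟨X, ⟨e⟩⟩ := h
  have : Nonempty X := hS.map fun s ↦ (e s).head
  rw [cohomologicalDimension_congr e]
  exact (cohomologicalDimension_freeSemigroup_le_one X).antisymm
    (one_le_cohomologicalDimension_freeSemigroup X)

/-- A subsemigroup `P` is left unitary if `x ∈ P` and `x * u ∈ P` imply `u ∈ P`. For left ideals of
free semigroups this is the property that links cohomological dimension one to freeness. -/
def LeftUnitary {S : Type*} [Mul S] (P : Subsemigroup S) : Prop :=
  ∀ ⦃x u⦄, x ∈ P → x * u ∈ P → u ∈ P

section LeftRegular

open MonoidAlgebra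

variable {S : Type u} [Semigroup S]

/-- The left regular module: `S` acts on `ℤ[S]` by left multiplication. -/
noncomputable def leftRegular (S : Type*) [Semigroup S] : Action S ℤ[S] where
  toFun s := .mulLeft (single s 1)
  map_mul' s t := AddMonoidHom.ext fun p ↦ by
    change single (s * t) 1 * p = single s 1 * (single t 1 * p)
    rw [← mul_assoc, single_mul_single, mul_one]

theorem leftRegular_apply (s : S) (p : ℤ[S]) : leftRegular S s p = single s 1 * p := rfl

theorem exists_primitive_of_mul_right_invariant (hcd : cohomologicalDimension S ≤ 1) {c : S → ℤ}
    (hc : ∀ s t, c (s * t) = c s) :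
    ∃ g : S → ℤ[S], ∀ s t, single s 1 * g t - g (s * t) + g s = single s (c t) := by
  let f : Cochain S ℤ[S] 2 := fun x ↦ single (x 0) (c (x 1))
  have hf : f ∈ cocycles (leftRegular S) 2 := by
    refine (mem_cocycles_two _).2 fun s t u ↦ ?_
    simp [f, leftRegular_apply, single_mul_single, hc]
  obtain ⟨g, hg⟩ := cohomologicalDimension_le_iff.1 hcd 2 one_lt_two ℤ[S] (leftRegular S) hf
  refine ⟨fun s ↦ g ![s], fun s t ↦ ?_⟩
  have h := congrFun hg ![s, t]
  rwa [coboundary_one_apply, leftRegular_apply] at h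

theorem leftUnitary_of_cohomologicalDimension_le_one [IsLeftCancelMul S] (hS : ∀ x y : S, x * y ≠ x)
    {L : SemigroupIdeal S} (hcd : cohomologicalDimension L.toSubsemigroup ≤ 1)
    {c : L.toSubsemigroup → ℤ} (hc : ∀ s t, c (s * t) = c s) (hne : ∃ s t, c s ≠ c t) :
    LeftUnitary L.toSubsemigroup := by
  intro x u hx hxu
  by_contra hu
  obtain ⟨g, hg⟩ := exists_primitive_of_mul_right_invariant hcd hc
  let x' : L.toSubsemigroup := ⟨x, hx⟩
  let w : L.toSubsemigroup := ⟨x * u, hxu⟩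
  suffices hconst : ∀ t, c t = (g w).coeff w - (g x').coeff w by
    obtain ⟨s, t, hst⟩ := hne
    exact hst ((hconst s).trans (hconst t).symm)
  intro t
  let v : L.toSubsemigroup := ⟨u * t, L.mul_mem u t.2⟩
  have hv : x' * v = w * t := Subtype.ext (mul_assoc x u t).symm
  have hxw : x' ≠ w := fun h ↦ hS x u (congrArg Subtype.val h).symm
  have hgv : (single x' 1 * g v).coeff w = 0 := coeff_single_mul_of_forall_mul_ne _ _ fun y hy ↦
    have hyu : y = u := mul_left_cancel (congrArg Subtype.val hy)
    hu (hyu ▸ y.2)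
  have hgt : (single w 1 * g t).coeff w = 0 := coeff_single_mul_of_forall_mul_ne _ _ fun y hy ↦
    hS w y (congrArg Subtype.val hy)
  have hcoeff_x : (g x').coeff w - (g (w * t)).coeff w = 0 := by
    simpa [hgv, hv, hxw, neg_add_eq_sub] using DFunLike.congr_fun (congrArg coeff (hg x' v)) w
  have hcoeff_w : (g w).coeff w - (g (w * t)).coeff w = c t := by
    simpa [hgt, neg_add_eq_sub] using DFunLike.congr_fun (congrArg coeff (hg w t)) w
  linarith

end LeftRegular

section Equidivisible

/-- Two factorizations of the same element of an equidivisible semigroup have a common refinement.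
By Levi's theorem, an equidivisible semigroup with a length function is free. -/
def Equidivisible (S : Type*) [Mul S] : Prop :=
  ∀ ⦃x y z t : S⦄, x * y = z * t →
    x = z ∧ y = t ∨ (∃ u, z = x * u ∧ y = u * t) ∨ ∃ u, x = z * u ∧ t = u * y

theorem Equidivisible.of_leftUnitary {S : Type*} [Mul S] (hS : Equidivisible S)
    {P : Subsemigroup S} (hP : LeftUnitary P) : Equidivisible P := by
  intro x y z t h
  rcases hS (congrArg Subtype.val h) with ⟨hxz, hyt⟩ | ⟨u, hz, hy⟩ | ⟨u, hx, ht⟩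
  · exact .inl ⟨Subtype.ext hxz, Subtype.ext hyt⟩
  · exact .inr (.inl ⟨⟨u, hP x.2 (hz ▸ z.2)⟩, Subtype.ext hz, Subtype.ext hy⟩)
  · exact .inr (.inr ⟨⟨u, hP z.2 (hx ▸ x.2)⟩, Subtype.ext hx, Subtype.ext ht⟩)

theorem of_mul_eq_of_mul_iff {X : Type*} {a b : X} {y z : FreeSemigroup X} :
    .of a * y = .of b * z ↔ a = b ∧ y = z := by
  simp [FreeSemigroup.ext_iff, FreeSemigroup.of]

theorem equidivisible_freeSemigroup (X : Type*) : Equidivisible (FreeSemigroup X) := by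
  intro x
  induction x using FreeSemigroup.recOnMul with
  | ih1 a =>
    intro y z t h
    cases z using FreeSemigroup.recOnMul with
    | ih1 b =>
      obtain ⟨rfl, rfl⟩ := of_mul_eq_of_mul_iff.1 h
      exact .inl ⟨rfl, rfl⟩
    | ih2 b z =>
      rw [mul_assoc] at h
      obtain ⟨rfl, rfl⟩ := of_mul_eq_of_mul_iff.1 h
      exact .inr (.inl ⟨z, rfl, rfl⟩)
  | ih2 a x _ ih =>
    intro y z t h
    rw [mul_assoc] at h
    cases z using FreeSemigroup.recOnMul with
    | ih1 b =>
      obtain ⟨rfl, rfl⟩ := of_mul_eq_of_mul_iff.1 h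
      exact .inr (.inr ⟨x, rfl, rfl⟩)
    | ih2 b z =>
      rw [mul_assoc] at h
      obtain ⟨rfl, hxy⟩ := of_mul_eq_of_mul_iff.1 h
      rcases ih hxy with ⟨rfl, rfl⟩ | ⟨u, rfl, rfl⟩ | ⟨u, rfl, rfl⟩
      · exact .inl ⟨rfl, rfl⟩
      · exact .inr (.inl ⟨u, (mul_assoc _ _ _).symm, rfl⟩)
      · exact .inr (.inr ⟨u, (mul_assoc _ _ _).symm, rfl⟩)

/-- The elements of a semigroup that are not products of two elements: the only possible free
generators. -/
def indecomposables (S : Type*) [Mul S] : Set S :=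
  {x | ∀ y z, x ≠ y * z}

theorem Equidivisible.indecomposable_mul_inj {S : Type*} [Mul S] (hS : Equidivisible S)
    {a b y z : S} (ha : a ∈ indecomposables S) (hb : b ∈ indecomposables S) (h : a * y = b * z) :
    a = b ∧ y = z :=
  (hS h).resolve_right <| by
    rintro (⟨u, hu, -⟩ | ⟨u, hu, -⟩)
    · exact hb a u hu
    · exact ha b u hu

/-- The homomorphism from the free semigroup on the indecomposables that multiplies out words. -/
def liftIndecomposables (S : Type*) [Semigroup S] : FreeSemigroup (indecomposables S) →ₙ* S :=
  FreeSemigroup.lift (↑)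

theorem Equidivisible.liftIndecomposables_injective {S : Type*} [Semigroup S]
    (hS : Equidivisible S) : Function.Injective (liftIndecomposables S) := by
  intro x
  induction x using FreeSemigroup.recOnMul with
  | ih1 a =>
    intro y h
    cases y using FreeSemigroup.recOnMul with
    | ih1 b => exact congrArg _ (Subtype.ext h)
    | ih2 b y => exact absurd (h.trans (map_mul _ _ _)) (a.2 _ _)
  | ih2 a x _ ih =>
    intro y h
    rw [map_mul] at h
    cases y using FreeSemigroup.recOnMul with
    | ih1 b => exact absurd h.symm (b.2 _ _)
    | ih2 b y =>
      rw [map_mul] at h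
      obtain ⟨hab, hxy⟩ := hS.indecomposable_mul_inj a.2 b.2 h
      rw [Subtype.ext hab, ih hxy]

theorem liftIndecomposables_surjective {S : Type*} [Semigroup S] (ℓ : S → ℕ)
    (hleft : ∀ x y, ℓ x < ℓ (x * y)) (hright : ∀ x y, ℓ y < ℓ (x * y)) :
    Function.Surjective (liftIndecomposables S) := by
  intro x
  induction x using (measure ℓ).wf.induction with | _ x ih =>
  by_cases hx : x ∈ indecomposables S
  · exact ⟨.of ⟨x, hx⟩, rfl⟩
  · obtain ⟨y, z, rfl⟩ : ∃ y z, x = y * z := by simpa [indecomposables] using hx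
    obtain ⟨v, hv⟩ := ih y (hleft y z)
    obtain ⟨w, hw⟩ := ih z (hright y z)
    exact ⟨v * w, by rw [map_mul, hv, hw]⟩

theorem Equidivisible.isFree {S : Type*} [Semigroup S] (hS : Equidivisible S) (ℓ : S → ℕ)
    (hleft : ∀ x y, ℓ x < ℓ (x * y)) (hright : ∀ x y, ℓ y < ℓ (x * y)) : IsFree S :=
  ⟨indecomposables S, ⟨(MulEquiv.ofBijective (liftIndecomposables S)
    ⟨hS.liftIndecomposables_injective, liftIndecomposables_surjective ℓ hleft hright⟩).symm⟩⟩

end Equidivisible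

section Words

variable {X : Type u}

theorem length_lt_length_mul_right (x y : FreeSemigroup X) : x.length < (x * y).length := by
  rw [FreeSemigroup.length_mul]
  exact Nat.lt_add_of_pos_right (Nat.succ_pos _)

theorem length_lt_length_mul_left (x y : FreeSemigroup X) : y.length < (x * y).length := by
  rw [FreeSemigroup.length_mul]
  exact Nat.lt_add_of_pos_left (Nat.succ_pos _)

theorem freeSemigroup_mul_ne_left (x y : FreeSemigroup X) : x * y ≠ x :=
  fun h ↦ (length_lt_length_mul_right x y).ne' (congrArg FreeSemigroup.length h)

instance : IsLeftCancelMul (FreeSemigroup X) where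
  mul_left_cancel x y z h := FreeSemigroup.toFreeMonoid_injective <|
    mul_left_cancel (a := x.toFreeMonoid) <| by
      simpa only [map_mul] using congrArg FreeSemigroup.toFreeMonoid h

theorem LeftUnitary.isFree {P : Subsemigroup (FreeSemigroup X)} (hP : LeftUnitary P) : IsFree P :=
  ((equidivisible_freeSemigroup X).of_leftUnitary hP).isFree (fun x ↦ x.1.length)
    (fun x y ↦ length_lt_length_mul_right x.1 y.1) (fun x y ↦ length_lt_length_mul_left x.1 y.1)

theorem leftUnitary_of_nontrivial [Nontrivial X] {L : SemigroupIdeal (FreeSemigroup X)}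
    (hcd : cohomologicalDimension L.toSubsemigroup ≤ 1) : LeftUnitary L.toSubsemigroup := by
  classical
  intro x u hx
  obtain ⟨a, b, hab⟩ := exists_pair_ne X
  refine leftUnitary_of_cohomologicalDimension_le_one freeSemigroup_mul_ne_left hcd
    (c := fun y ↦ if y.1.head = a then 1 else 0) (fun _ _ ↦ rfl) ?_ hx
  refine ⟨⟨.of a * x, L.mul_mem _ hx⟩, ⟨.of b * x, L.mul_mem _ hx⟩, ?_⟩
  simp [FreeSemigroup.of, hab.symm]

end Words

end SemigroupCohomology

theorem proposition4 {α : Type u} [Nontrivial α] (L : SemigroupIdeal (FreeSemigroup α))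
    (hL : (L : Set (FreeSemigroup α)).Nonempty) :
    SemigroupCohomology.cohomologicalDimension L.toSubsemigroup = 1 ↔
      SemigroupCohomology.IsFree L.toSubsemigroup := by
  have : Nonempty L.toSubsemigroup := hL.to_subtype
  exact ⟨fun hcd ↦ (SemigroupCohomology.leftUnitary_of_nontrivial hcd.le).isFree,
    SemigroupCohomology.cohomologicalDimension_eq_one_of_isFree⟩
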